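/- Let $d\in\mathbb{N}$ and let $\mathcal{P}_2(\mathbb{R}^d)$ be the set of Borel probability measures on $\mathbb{R}^d$ with finite second moment, with the $L^2$-Wasserstein distance $$W_2^2(\mu,\nu)=\inf_{\gamma\in\Pi(\mu,\nu)}\int |x-y|^2\,\mathrm{d}\gamma(x,y),$$ where $\Pi(\mu,\nu)$ is the set of probability measures on $\mathbb{R}^d\times\mathbb{R}^d$ with marginals $\mu$ and $\nu$. Let $\alpha>1$ and $\beta=\alpha-1$, and for $\mu_0,\mu_1,\rho\in\mathcal{P}_2(\mathbb{R}^d)$ set $$\mathcal{F}(\mu_0,\mu_1;\rho)=\alpha W_2^2(\rho,\mu_1)-\beta W_2^2(\rho,\mu_0).$$ Then for all $\mu_0,\mu_1\in\mathcal{P}_2(\mathbb{R}^d)$ the metric extrapolation problem $$\min_{\rho\in\mathcal{P}_2(\mathbb{R}^d)}\mathcal{F}(\mu_0,\mu_1;\rho)$$ admits a unique solution $\mu_\alpha$. Moreover, the metric extrapolation $(\mu_0,\mu_1)\mapsto\mu_\alpha$ is $\beta$-dissipative, i.e. for all $\mu_0,\mu_1\in\mathcal{P}_2(\mathbb{R}^d)$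 $$W_2(\mu_1,\mu_\alpha)\le\beta\,W_2(\mu_0,\mu_1),$$ and for all $\mu_0,\mu_1,\mu\in\mathcal{P}_2(\mathbb{R}^d)$ $$W_2^2(\mu,\mu_\alpha)+\mathcal{F}(\mu_0,\mu_1;\mu_\alpha)\le\mathcal{F}(\mu_0,\mu_1;\mu).$$ -/

import Mathlib

open MeasureTheory Set
open scoped ENNReal

namespace WassersteinExtrapolation

/-- The set `P₂(ℝᵈ)` of Borel probability measures on Euclidean space `ℝᵈ` with finite second
moment. -/
abbrev P2 (d : ℕ) : Type :=
  {μ : ProbabilityMeasure (EuclideanSpace ℝ (Fin d)) //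
    ∫⁻ x, ‖x‖ₑ ^ 2 ∂(μ : Measure (EuclideanSpace ℝ (Fin d))) < ∞}

/-- The underlying measure of an element of `P₂(ℝᵈ)`. -/
def P2.toMeasure {d : ℕ} (μ : P2 d) : Measure (EuclideanSpace ℝ (Fin d)) :=
  (μ.1 : Measure (EuclideanSpace ℝ (Fin d)))

instance {d : ℕ} (μ : P2 d) : IsProbabilityMeasure μ.toMeasure :=
  inferInstanceAs (IsProbabilityMeasure (μ.1 : Measure (EuclideanSpace ℝ (Fin d))))

/-- The set `Π(μ, ν)` of transport plans: measures on `ℝᵈ × ℝᵈ` with marginals `μ` and `ν`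
(these are automatically probability measures, as `μ` and `ν` are). -/
def couplings {d : ℕ} (μ ν : P2 d) :
    Set (Measure (EuclideanSpace ℝ (Fin d) × EuclideanSpace ℝ (Fin d))) :=
  {γ | γ.map Prod.fst = μ.toMeasure ∧ γ.map Prod.snd = ν.toMeasure}

/-- The optimal transport cost `inf_{γ ∈ Π(μ, ν)} ∫ |x - y|² dγ(x, y)`, in `[0, ∞]`. -/
noncomputable def transportCost {d : ℕ} (μ ν : P2 d) : ℝ≥0∞ :=
  ⨅ γ ∈ couplings μ ν, ∫⁻ p, ‖p.1 - p.2‖ₑ ^ 2 ∂γ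

/-- The optimal transport cost between elements of `P₂(ℝᵈ)` is finite, so that nothing is lost
by regarding it as a real number. -/
theorem transportCost_lt_top {d : ℕ} (μ ν : P2 d) : transportCost μ ν < ∞ := by
  have hmem : μ.toMeasure.prod ν.toMeasure ∈ couplings μ ν := by
    constructor <;> simp [Measure.map_fst_prod, Measure.map_snd_prod]
  refine (iInf₂_le _ hmem).trans_lt ?_
  have hle : ∀ p : EuclideanSpace ℝ (Fin d) × EuclideanSpace ℝ (Fin d),
      ‖p.1 - p.2‖ₑ ^ 2 ≤ 2 * ‖p.1‖ₑ ^ 2 + 2 * ‖p.2‖ₑ ^ 2 := by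
    intro p
    have h1 : ‖p.1 - p.2‖₊ ^ 2 ≤ 2 * ‖p.1‖₊ ^ 2 + 2 * ‖p.2‖₊ ^ 2 := by
      rw [← NNReal.coe_le_coe]
      push_cast
      nlinarith [norm_sub_le p.1 p.2, norm_nonneg (p.1 - p.2), sq_nonneg (‖p.1‖ - ‖p.2‖)]
    simp only [enorm_eq_nnnorm]
    exact_mod_cast h1
  refine (lintegral_mono hle).trans_lt ?_
  have hm : Measurable fun x : EuclideanSpace ℝ (Fin d) => 2 * ‖x‖ₑ ^ 2 := by fun_prop
  have hμ : ∫⁻ x, ‖x‖ₑ ^ 2 ∂μ.toMeasure < ∞ := μ.2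
  have hν : ∫⁻ x, ‖x‖ₑ ^ 2 ∂ν.toMeasure < ∞ := ν.2
  rw [lintegral_add_left (by fun_prop),
    ← lintegral_map (μ := μ.toMeasure.prod ν.toMeasure) hm measurable_fst,
    ← lintegral_map (μ := μ.toMeasure.prod ν.toMeasure) hm measurable_snd, hmem.1, hmem.2,
    lintegral_const_mul _ (by fun_prop), lintegral_const_mul _ (by fun_prop)]
  exact ENNReal.add_lt_top.2
    ⟨ENNReal.mul_lt_top (by simp) hμ, ENNReal.mul_lt_top (by simp) hν⟩

/-- The `L²`-Wasserstein distance on `P₂(ℝᵈ)`. -/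
noncomputable def W2 {d : ℕ} (μ ν : P2 d) : ℝ :=
  Real.sqrt (transportCost μ ν).toReal

/-- The functional `ρ ↦ α W₂²(ρ, μ₁) - β W₂²(ρ, μ₀)` with `β = α - 1`. -/
noncomputable def extrapolationFunctional {d : ℕ} (α : ℝ) (μ₀ μ₁ ρ : P2 d) : ℝ :=
  α * W2 ρ μ₁ ^ 2 - (α - 1) * W2 ρ μ₀ ^ 2

/-- `ρ` solves the metric extrapolation problem for `(μ₀, μ₁)` at time `α`, that is, it minimizes
the extrapolation functional over all of `P₂(ℝᵈ)`. -/
def IsMetricExtrapolation {d : ℕ} (α : ℝ) (μ₀ μ₁ ρ : P2 d) : Prop :=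
  IsMinOn (extrapolationFunctional α μ₀ μ₁) univ ρ

/-- An extrapolation operator `E : P₂(ℝᵈ) × P₂(ℝᵈ) → P₂(ℝᵈ)` is `θ`-dissipative (`θ ≥ 0`) if
`W₂(μ₁, E(μ₀, μ₁)) ≤ θ W₂(μ₀, μ₁)` for all `μ₀, μ₁`. -/
def IsDissipative {d : ℕ} (θ : ℝ) (E : P2 d → P2 d → P2 d) : Prop :=
  0 ≤ θ ∧ ∀ μ₀ μ₁ : P2 d, W2 μ₁ (E μ₀ μ₁) ≤ θ * W2 μ₀ μ₁

end WassersteinExtrapolation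

/-!
The law of a random vector is a 1-Lipschitz map from `L²(P)` to `P₂(ℝᵈ)`, and an optimal coupling
of the law of `X` with `ν` is realised in `L²` of an extension of `P`. The Hilbert space identity
for `‖(1 - t) X + t Y - Z‖²` therefore makes `W₂²(·, law Z)` convex along `law ((1 - t) X + t Y)`
when `X` and `Y` are both optimally coupled to `Z`, while `W₂²(·, ν)` is semiconcave along such
curves for every `ν`. Both errors have the form `t (1 - t) ‖X - Y‖²`, so with the weights `α` and
`-(α - 1)` the extrapolation functional is 2-strongly convex along curves based at `law Z = μ₁`. As
`(P₂(ℝᵈ), W₂)` is complete, this gives a unique minimizer; comparing it with nearby points of these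
curves yields the strengthened minimality inequality, and its instance at `μ₁` is the dissipativity
estimate.
-/

namespace WassersteinExtrapolation

open Filter Topology ProbabilityTheory
open scoped NNReal

section MetricSpace

variable {X : Type*} [PseudoMetricSpace X] {f : X → ℝ} {m : ℝ}

/-- `m`-strong convexity of a function on a metric space, normalised as in `StrongConvexOn`: any two
points admit, at every time `t`, an intermediate point at which the strong convexity inequality
holds. The intermediate points need not form a curve, let alone a geodesic, since only minimizers
of `f` are studied. -/
def MetricStrongConvex (m : ℝ) (f : X → ℝ) : Prop :=
  ∀ x y, ∀ t ∈ Icc (0 : ℝ) 1, ∃ z,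
    f z ≤ (1 - t) * f x + t * f y - t * (1 - t) * (m / 2 * dist x y ^ 2)

namespace MetricStrongConvex

theorem dist_sq_add_le_of_isMinOn (hf : MetricStrongConvex m f) {x : X} (hx : IsMinOn f univ x)
    (y : X) : m / 2 * dist x y ^ 2 + f x ≤ f y := by
  have hlim : Tendsto (fun t : ℝ => (1 - t) * (m / 2 * dist x y ^ 2) + f x) (𝓝[>] 0)
      (𝓝 (m / 2 * dist x y ^ 2 + f x)) := by
    refine tendsto_nhdsWithin_of_tendsto_nhds (Continuous.tendsto' (by fun_prop) _ _ (by simp))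
  refine le_of_tendsto hlim ?_
  filter_upwards [Ioo_mem_nhdsGT one_pos] with t ht
  obtain ⟨z, hz⟩ := hf x y t (Ioo_subset_Icc_self ht)
  have hmin : f x ≤ f z := hx (mem_univ z)
  have hscaled : t * ((1 - t) * (m / 2 * dist x y ^ 2) + f x) ≤ t * f y := by linarith
  exact le_of_mul_le_mul_left hscaled ht.1

theorem dist_eq_zero_of_isMinOn (hf : MetricStrongConvex m f) (hm : 0 < m) {x y : X}
    (hx : IsMinOn f univ x) (hy : IsMinOn f univ y) : dist x y = 0 := by
  have hle : m / 2 * dist x y ^ 2 ≤ 0 := by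
    linarith [hf.dist_sq_add_le_of_isMinOn hx y, show f y ≤ f x from hy (mem_univ x)]
  have hsq : dist x y ^ 2 ≤ 0 := nonpos_of_mul_nonpos_right hle (half_pos hm)
  exact pow_eq_zero_iff two_ne_zero |>.1 (hsq.antisymm (sq_nonneg _))

theorem dist_sq_le (hf : MetricStrongConvex m f) (hm : 0 < m) {c ε : ℝ} (hc : ∀ z, c ≤ f z)
    {x y : X} (hx : f x ≤ c + ε) (hy : f y ≤ c + ε) : dist x y ^ 2 ≤ 8 / m * ε := by
  obtain ⟨z, hz⟩ := hf x y (1 / 2) (by norm_num)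
  have hle : m * dist x y ^ 2 ≤ 8 * ε := by linarith [hc z]
  rwa [div_mul_eq_mul_div, le_div_iff₀' hm]

theorem exists_isMinOn [Nonempty X] [CompleteSpace X] (hf : MetricStrongConvex m f) (hm : 0 < m)
    (hlsc : LowerSemicontinuous f) (hbdd : BddBelow (range f)) : ∃ x, IsMinOn f univ x := by
  set c := sInf (range f)
  have hc (z : X) : c ≤ f z := csInf_le hbdd (mem_range_self z)
  obtain ⟨v, hv_anti, hv_lim, hv_mem⟩ := exists_seq_tendsto_sInf (range_nonempty f) hbdd
  choose u hu using hv_mem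
  have hcauchy : CauchySeq u := by
    refine cauchySeq_of_le_tendsto_0 (fun N => √(8 / m * (v N - c))) (fun i j N hi hj => ?_) ?_
    · refine Real.le_sqrt_of_sq_le (hf.dist_sq_le hm hc ?_ ?_)
      · linarith [hu i, hv_anti hi]
      · linarith [hu j, hv_anti hj]
    · have hsub : Tendsto (fun N => v N - c) atTop (𝓝 0) := tendsto_sub_nhds_zero_iff.2 hv_lim
      simpa using (hsub.const_mul (8 / m)).sqrt
  obtain ⟨x, hx⟩ := cauchySeq_tendsto_of_complete hcauchy
  refine ⟨x, fun y _ => ?_⟩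
  have hfx : f x ≤ c := by
    refine le_of_forall_lt_imp_le_of_dense fun b hb => ge_of_tendsto hv_lim ?_
    filter_upwards [hx.eventually (hlsc x b hb)] with n hn
    exact (hu n ▸ hn).le
  exact hfx.trans (hc y)

end MetricStrongConvex

/-- The extrapolation functional of a metric space, of which `extrapolationFunctional` is the
instance given by `W2`. -/
def distExtrapolation (α : ℝ) (x₀ x₁ x : X) : ℝ :=
  α * dist x x₁ ^ 2 - (α - 1) * dist x x₀ ^ 2

variable {α : ℝ}

theorem continuous_distExtrapolation (x₀ x₁ : X) : Continuous (distExtrapolation α x₀ x₁) := by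
  unfold distExtrapolation
  fun_prop

theorem bddBelow_range_distExtrapolation (hα : 1 ≤ α) (x₀ x₁ : X) :
    BddBelow (range (distExtrapolation α x₀ x₁)) := by
  refine ⟨-(α * (α - 1) * dist x₁ x₀ ^ 2), ?_⟩
  rintro _ ⟨x, rfl⟩
  have htri : dist x x₀ ^ 2 ≤ (dist x x₁ + dist x₁ x₀) ^ 2 := by
    gcongr
    exact dist_triangle x x₁ x₀
  calc -(α * (α - 1) * dist x₁ x₀ ^ 2)
    _ ≤ -(α * (α - 1) * dist x₁ x₀ ^ 2) + (dist x x₁ - (α - 1) * dist x₁ x₀) ^ 2 :=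
      le_add_of_nonneg_right (sq_nonneg _)
    _ = α * dist x x₁ ^ 2 - (α - 1) * (dist x x₁ + dist x₁ x₀) ^ 2 := by ring
    _ ≤ distExtrapolation α x₀ x₁ x :=
      sub_le_sub_left (mul_le_mul_of_nonneg_left htri (sub_nonneg.2 hα)) _

theorem dist_le_of_dist_sq_add_distExtrapolation_le (hα : 1 ≤ α) {x₀ x₁ x : X}
    (h : dist x₁ x ^ 2 + distExtrapolation α x₀ x₁ x ≤ distExtrapolation α x₀ x₁ x₁) :
    dist x₁ x ≤ (α - 1) * dist x₀ x₁ := by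
  have htri : dist x x₀ ^ 2 ≤ (dist x₁ x + dist x₀ x₁) ^ 2 := by
    gcongr
    rw [add_comm, dist_comm x x₀]
    exact dist_triangle x₀ x₁ x
  have hmul := mul_le_mul_of_nonneg_left htri (sub_nonneg.2 hα)
  simp only [distExtrapolation, dist_self, dist_comm x x₁, dist_comm x₁ x₀] at h
  have hkey : dist x₁ x * dist x₁ x ≤ dist x₁ x * ((α - 1) * dist x₀ x₁) := by linarith
  rcases (dist_nonneg (x := x₁) (y := x)).eq_or_lt' with hzero | hpos
  · rw [hzero]
    exact mul_nonneg (sub_nonneg.2 hα) dist_nonneg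
  · exact le_of_mul_le_mul_left hkey hpos

end MetricSpace

section WeakTopology

theorem lowerSemicontinuous_lintegral {X : Type*} [TopologicalSpace X] [MeasurableSpace X]
    [OpensMeasurableSpace X] {c : X → ℝ≥0∞} (hc : Continuous c) :
    LowerSemicontinuous fun μ : ProbabilityMeasure X => ∫⁻ x, c x ∂(μ : Measure X) := by
  have htop (n : ℕ) (x : X) : min (c x) n ≠ ∞ :=
    ((min_le_right _ _).trans_lt (ENNReal.natCast_lt_top n)).ne
  let truncation (n : ℕ) : BoundedContinuousFunction X ℝ≥0 :=
    .mkOfBound ⟨fun x => (min (c x) n).toNNReal, ENNReal.continuousOn_toNNReal.comp_continuous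
      (by fun_prop) (htop n)⟩ n fun x y => by
      have hmem (z : X) : ((min (c z) n).toNNReal : ℝ) ∈ Icc 0 (n : ℝ) :=
        ⟨NNReal.coe_nonneg _, ENNReal.toReal_mono (by finiteness) (min_le_right (c z) n)⟩
      simpa [NNReal.dist_eq, Real.dist_eq] using Real.dist_le_of_mem_Icc (hmem x) (hmem y)
  have hcoe (n : ℕ) (x : X) : (truncation n x : ℝ≥0∞) = min (c x) n :=
    ENNReal.coe_toNNReal (htop n x)
  have hlintegral (μ : ProbabilityMeasure X) :
      ∫⁻ x, c x ∂(μ : Measure X) = ⨆ n, ∫⁻ x, truncation n x ∂(μ : Measure X) := by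
    simp_rw [hcoe]
    rw [← lintegral_iSup (fun n => by fun_prop)
      fun m n hmn x => min_le_min_left (c x) (Nat.cast_le.2 hmn)]
    simp [← inf_iSup_eq, ENNReal.iSup_natCast]
  simp_rw [hlintegral]
  exact lowerSemicontinuous_iSup fun n =>
    (ProbabilityMeasure.continuous_lintegral_boundedContinuousFunction
      (truncation n)).lowerSemicontinuous

theorem isTightMeasureSet_of_lintegral_enorm_pow_le {E : Type*} [NormedAddCommGroup E]
    [ProperSpace E] [MeasurableSpace E] [OpensMeasurableSpace E] {S : Set (Measure E)} {n : ℕ}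
    (hn : n ≠ 0) {C : ℝ≥0∞} (hC : C ≠ ∞) (hS : ∀ μ ∈ S, ∫⁻ x, ‖x‖ₑ ^ n ∂μ ≤ C) :
    IsTightMeasureSet S := by
  refine isTightMeasureSet_of_tendsto_measure_norm_gt ?_
  have htail (r : ℝ) (hr : 0 < r) : ⨆ μ ∈ S, μ {x | r < ‖x‖} ≤ C / ENNReal.ofReal r ^ n := by
    refine iSup₂_le fun μ hμ => ?_
    calc μ {x | r < ‖x‖}
      _ ≤ μ {x | ENNReal.ofReal r ^ n ≤ ‖x‖ₑ ^ n} := by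
        refine measure_mono (ofPred_subset_ofPred.2 fun x hx => pow_le_pow_left₀ zero_le ?_ n)
        exact ofReal_norm x ▸ ENNReal.ofReal_le_ofReal hx.le
      _ ≤ (∫⁻ x, ‖x‖ₑ ^ n ∂μ) / ENNReal.ofReal r ^ n :=
        meas_ge_le_lintegral_div (by fun_prop) (by positivity) (by finiteness)
      _ ≤ C / ENNReal.ofReal r ^ n := by gcongr; exact hS μ hμ
  have hlim : Tendsto (fun r : ℝ => C / ENNReal.ofReal r ^ n) atTop (𝓝 0) := by
    have hpow : Tendsto (fun r : ℝ => ENNReal.ofReal r ^ n) atTop (𝓝 ∞) := by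
      simpa [hn] using ENNReal.Tendsto.pow (n := n) ENNReal.tendsto_ofReal_atTop
    simpa using ENNReal.Tendsto.const_div hpow (.inr hC)
  exact tendsto_of_tendsto_of_tendsto_of_le_of_le' tendsto_const_nhds hlim
    (.of_forall fun _ => zero_le) ((eventually_gt_atTop 0).mono htail)

theorem isCompact_setOfPred_lintegral_enorm_pow_le {E : Type*} [NormedAddCommGroup E]
    [ProperSpace E] [MeasurableSpace E] [BorelSpace E] {n : ℕ} (hn : n ≠ 0) {C : ℝ≥0∞}
    (hC : C ≠ ∞) :
    IsCompact {μ : ProbabilityMeasure E | ∫⁻ x, ‖x‖ₑ ^ n ∂(μ : Measure E) ≤ C} := by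
  have hclosed : IsClosed {μ : ProbabilityMeasure E | ∫⁻ x, ‖x‖ₑ ^ n ∂(μ : Measure E) ≤ C} :=
    (lowerSemicontinuous_lintegral (by fun_prop)).isClosed_preimage C
  rw [← hclosed.closure_eq]
  refine isCompact_closure_of_isTightMeasureSet
    (isTightMeasureSet_of_lintegral_enorm_pow_le hn hC ?_)
  rintro _ ⟨μ, hμ, rfl⟩
  exact hμ

/-- The pair of marginals of a probability measure on a product space. -/
noncomputable def marginals {X Y : Type*} [MeasurableSpace X] [MeasurableSpace Y]
    (γ : ProbabilityMeasure (X × Y)) : ProbabilityMeasure X × ProbabilityMeasure Y :=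
  (γ.map measurable_fst.aemeasurable, γ.map measurable_snd.aemeasurable)

section OptimalTransport

variable {X Y : Type*} [MetricSpace X] [CompleteSpace X] [SecondCountableTopology X]
  [MeasurableSpace X] [BorelSpace X] [MetricSpace Y] [CompleteSpace Y] [SecondCountableTopology Y]
  [MeasurableSpace Y] [BorelSpace Y] {c : X × Y → ℝ≥0∞}

theorem isProperMap_marginals : IsProperMap (marginals : ProbabilityMeasure (X × Y) → _) := by
  have hcont : Continuous (marginals : ProbabilityMeasure (X × Y) → _) :=
    (ProbabilityMeasure.continuous_map continuous_fst).prodMk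
      (ProbabilityMeasure.continuous_map continuous_snd)
  refine isProperMap_iff_isCompact_preimage.2 ⟨hcont, fun K hK => ?_⟩
  rw [← (hK.isClosed.preimage hcont).closure_eq]
  refine isCompact_closure_of_isTightMeasureSet (.prodMk ?_ ?_)
  · refine (isTightMeasureSet_of_isCompact_closure (hK.image continuous_fst).closure).subset ?_
    rintro _ ⟨_, ⟨γ, hγ, rfl⟩, rfl⟩
    exact ⟨_, mem_image_of_mem Prod.fst hγ, rfl⟩
  · refine (isTightMeasureSet_of_isCompact_closure (hK.image continuous_snd).closure).subset ?_
    rintro _ ⟨_, ⟨γ, hγ, rfl⟩, rfl⟩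
    exact ⟨_, mem_image_of_mem Prod.snd hγ, rfl⟩

theorem exists_marginals_eq_forall_lintegral_le (hc : Continuous c) (μ : ProbabilityMeasure X)
    (ν : ProbabilityMeasure Y) :
    ∃ γ, marginals γ = (μ, ν) ∧ ∀ γ', marginals γ' = (μ, ν) →
      ∫⁻ p, c p ∂(γ : Measure (X × Y)) ≤ ∫⁻ p, c p ∂(γ' : Measure (X × Y)) := by
  have hcompact : IsCompact (marginals ⁻¹' {(μ, ν)}) :=
    isProperMap_marginals.isCompact_preimage isCompact_singleton
  have hnonempty : (marginals ⁻¹' {(μ, ν)}).Nonempty :=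
    ⟨μ.prod ν, Prod.ext (μ.map_fst_prod ν) (μ.map_snd_prod ν)⟩
  exact ((lowerSemicontinuous_lintegral hc).lowerSemicontinuousOn _).exists_isMinOn hnonempty
    hcompact

theorem isClosed_image_marginals_lintegral_le (hc : Continuous c) (C : ℝ≥0∞) :
    IsClosed (marginals '' {γ : ProbabilityMeasure (X × Y) |
      ∫⁻ p, c p ∂(γ : Measure (X × Y)) ≤ C}) :=
  isProperMap_marginals.isClosedMap _ ((lowerSemicontinuous_lintegral hc).isClosed_preimage C)

end OptimalTransport

end WeakTopology

section Wasserstein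

variable {d : ℕ}

theorem mem_couplings_iff {μ ν : P2 d}
    {γ : Measure (EuclideanSpace ℝ (Fin d) × EuclideanSpace ℝ (Fin d))} :
    γ ∈ couplings μ ν ↔ ∃ γ' : ProbabilityMeasure _, marginals γ' = (μ.1, ν.1) ∧ γ' = γ := by
  constructor
  · intro hγ
    have : IsProbabilityMeasure (γ.map Prod.fst) := hγ.1 ▸ inferInstance
    have := Measure.isProbabilityMeasure_of_map (μ := γ) Prod.fst
    exact ⟨⟨γ, ‹_›⟩, Prod.ext (Subtype.ext hγ.1) (Subtype.ext hγ.2), rfl⟩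
  · rintro ⟨γ', hγ', rfl⟩
    obtain ⟨hμ, hν⟩ := Prod.mk.inj hγ'
    exact ⟨congrArg ProbabilityMeasure.toMeasure hμ, congrArg ProbabilityMeasure.toMeasure hν⟩

theorem exists_optimal_coupling (μ ν : P2 d) :
    ∃ γ ∈ couplings μ ν, ∫⁻ p, ‖p.1 - p.2‖ₑ ^ 2 ∂γ = transportCost μ ν := by
  obtain ⟨γ, hγ, hmin⟩ := exists_marginals_eq_forall_lintegral_le
    (c := fun p => ‖p.1 - p.2‖ₑ ^ 2) (by fun_prop) μ.1 ν.1
  have hmem : (γ : Measure _) ∈ couplings μ ν := mem_couplings_iff.2 ⟨γ, hγ, rfl⟩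
  refine ⟨γ, hmem, le_antisymm (le_iInf₂ fun γ' hγ' => ?_) (iInf₂_le _ hmem)⟩
  obtain ⟨γ', hmarginals, rfl⟩ := mem_couplings_iff.1 hγ'
  exact hmin γ' hmarginals

theorem transportCost_le_iff {μ ν : P2 d} {C : ℝ≥0∞} :
    transportCost μ ν ≤ C ↔ ∃ γ ∈ couplings μ ν, ∫⁻ p, ‖p.1 - p.2‖ₑ ^ 2 ∂γ ≤ C := by
  refine ⟨fun h => ?_, fun ⟨γ, hγ, hle⟩ => (iInf₂_le γ hγ).trans hle⟩
  obtain ⟨γ, hγ, hcost⟩ := exists_optimal_coupling μ ν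
  exact ⟨γ, hγ, hcost.trans_le h⟩

theorem lowerSemicontinuous_transportCost :
    LowerSemicontinuous fun p : P2 d × P2 d => transportCost p.1 p.2 := by
  refine lowerSemicontinuous_iff_isClosed_preimage.2 fun C => ?_
  have hclosed := isClosed_image_marginals_lintegral_le (C := C)
    (c := fun p : EuclideanSpace ℝ (Fin d) × EuclideanSpace ℝ (Fin d) => ‖p.1 - p.2‖ₑ ^ 2)
    (by fun_prop)
  convert hclosed.preimage (continuous_subtype_val.prodMap continuous_subtype_val)
  ext p
  simp only [mem_preimage, mem_Iic, transportCost_le_iff, mem_couplings_iff]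
  exact ⟨fun ⟨_, ⟨γ, hγ, rfl⟩, hle⟩ => ⟨γ, hle, hγ⟩, fun ⟨γ, hle, hγ⟩ => ⟨γ, ⟨γ, hγ, rfl⟩, hle⟩⟩

theorem W2_nonneg (μ ν : P2 d) : 0 ≤ W2 μ ν := Real.sqrt_nonneg _

theorem ofReal_W2_sq (μ ν : P2 d) : ENNReal.ofReal (W2 μ ν ^ 2) = transportCost μ ν := by
  rw [W2, Real.sq_sqrt ENNReal.toReal_nonneg, ENNReal.ofReal_toReal (transportCost_lt_top μ ν).ne]

theorem W2_le_iff {μ ν : P2 d} {r : ℝ} (hr : 0 ≤ r) :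
    W2 μ ν ≤ r ↔ transportCost μ ν ≤ ENNReal.ofReal (r ^ 2) := by
  rw [← ofReal_W2_sq, ENNReal.ofReal_le_ofReal_iff (sq_nonneg r), sq_le_sq₀ (W2_nonneg μ ν) hr]

theorem isClosed_setOfPred_W2_le {r : ℝ} (hr : 0 ≤ r) :
    IsClosed {p : P2 d × P2 d | W2 p.1 p.2 ≤ r} := by
  simp only [W2_le_iff hr]
  exact lowerSemicontinuous_transportCost.isClosed_preimage _

theorem W2_comm (μ ν : P2 d) : W2 μ ν = W2 ν μ := by
  have hle (μ ν : P2 d) : W2 μ ν ≤ W2 ν μ := by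
    rw [W2_le_iff (W2_nonneg ν μ), ofReal_W2_sq]
    refine le_iInf₂ fun γ hγ => transportCost_le_iff.2 ⟨γ.map Prod.swap, ⟨?_, ?_⟩, ?_⟩
    · rw [Measure.map_map measurable_fst measurable_swap]
      exact hγ.2
    · rw [Measure.map_map measurable_snd measurable_swap]
      exact hγ.1
    · rw [lintegral_map (by fun_prop) measurable_swap]
      simp [enorm_sub_rev]
  exact (hle μ ν).antisymm (hle ν μ)

theorem eq_of_W2_eq_zero {μ ν : P2 d} (h : W2 μ ν = 0) : μ = ν := by
  obtain ⟨γ, hγ, hcost⟩ := exists_optimal_coupling μ ν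
  rw [← ofReal_W2_sq, h] at hcost
  have hae : Prod.fst =ᵐ[γ] Prod.snd := by
    filter_upwards [(lintegral_eq_zero_iff (by fun_prop)).1 (hcost.trans (by simp))] with p hp
    simpa [sub_eq_zero] using hp
  exact Subtype.ext (Subtype.ext (hγ.1.symm.trans ((Measure.map_congr hae).trans hγ.2)))

end Wasserstein

section Laws

theorem eLpNorm_two_sq {Ω E : Type*} [MeasurableSpace Ω] [NormedAddCommGroup E] {P : Measure Ω}
    (f : Ω → E) : eLpNorm f 2 P ^ 2 = ∫⁻ ω, ‖f ω‖ₑ ^ 2 ∂P := by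
  simpa using eLpNorm_nnreal_pow_eq_lintegral (f := f) (μ := P) (p := 2) two_ne_zero

theorem edist_sq_eq_lintegral {Ω E : Type*} [MeasurableSpace Ω] [NormedAddCommGroup E]
    {P : Measure Ω} (X Y : Lp E 2 P) : edist X Y ^ 2 = ∫⁻ ω, ‖X ω - Y ω‖ₑ ^ 2 ∂P := by
  rw [Lp.edist_def, eLpNorm_two_sq]
  rfl

theorem exists_fst_eq_map_prodMap_eq {Ω X Y : Type*} [MeasurableSpace Ω] [MeasurableSpace X]
    [MeasurableSpace Y] [StandardBorelSpace Y] [Nonempty Y] {P : Measure Ω} [SFinite P]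
    {Z : Ω → X} (hZ : Measurable Z) {γ : Measure (X × Y)} [IsFiniteMeasure γ]
    (hγ : γ.fst = P.map Z) : ∃ Q : Measure (Ω × Y), Q.fst = P ∧ Q.map (Prod.map Z id) = γ := by
  refine ⟨P ⊗ₘ γ.condKernel.comap Z hZ, Measure.fst_compProd _ _, ?_⟩
  refine Eq.trans ?_ (γ.disintegrate γ.condKernel)
  have hmap : Measurable (Prod.map Z (id : Y → Y)) := by fun_prop
  ext s hs
  rw [Measure.map_apply hmap hs, Measure.compProd_apply (hmap hs), Measure.compProd_apply hs, hγ,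
    lintegral_map (Kernel.measurable_kernel_prodMk_left hs) hZ]
  rfl

variable {d : ℕ} {Ω : Type*} [MeasurableSpace Ω] {P : Measure Ω} [IsProbabilityMeasure P]

/-- The law of a square-integrable random vector, as an element of `P₂(ℝᵈ)`. -/
noncomputable def law (X : Lp (EuclideanSpace ℝ (Fin d)) 2 P) : P2 d :=
  ⟨⟨P.map X, Measure.isProbabilityMeasure_map (Lp.aestronglyMeasurable X).aemeasurable⟩, by
    have hmem : MemLp id 2 (P.map X) :=
      (memLp_map_measure_iff aestronglyMeasurable_id (by fun_prop)).2 (Lp.memLp X)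
    simpa [eLpNorm_two_sq] using ENNReal.pow_lt_top (n := 2) hmem.2⟩

theorem law_eq_of_ae_eq {X : Lp (EuclideanSpace ℝ (Fin d)) 2 P} {f : Ω → EuclideanSpace ℝ (Fin d)}
    {μ : P2 d} (hX : X =ᵐ[P] f) (hf : P.map f = μ.toMeasure) : law X = μ :=
  Subtype.ext (Subtype.ext ((Measure.map_congr hX).trans hf))

theorem memLp_id_toMeasure (μ : P2 d) : MemLp id 2 μ.toMeasure :=
  ⟨aestronglyMeasurable_id, by
    have hsq : eLpNorm id 2 μ.toMeasure ^ 2 < ∞ := (eLpNorm_two_sq _).trans_lt μ.2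
    simpa using hsq⟩

theorem lintegral_enorm_sq_law (X : Lp (EuclideanSpace ℝ (Fin d)) 2 P) :
    ∫⁻ x, ‖x‖ₑ ^ 2 ∂(law X).toMeasure = ‖X‖ₑ ^ 2 := by
  rw [Lp.enorm_def, eLpNorm_two_sq]
  exact lintegral_map' (by fun_prop) (by fun_prop)

theorem W2_law_le_dist (X Y : Lp (EuclideanSpace ℝ (Fin d)) 2 P) :
    W2 (law X) (law Y) ≤ dist X Y := by
  rw [W2_le_iff dist_nonneg, ENNReal.ofReal_pow dist_nonneg, ← edist_dist, edist_sq_eq_lintegral]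
  have hXY : AEMeasurable (fun ω => (X ω, Y ω)) P := by fun_prop
  refine transportCost_le_iff.2 ⟨P.map fun ω => (X ω, Y ω), ⟨?_, ?_⟩, ?_⟩
  · exact AEMeasurable.map_map_of_aemeasurable measurable_fst.aemeasurable hXY
  · exact AEMeasurable.map_map_of_aemeasurable measurable_snd.aemeasurable hXY
  · rw [lintegral_map' (by fun_prop) hXY]

theorem law_compMeasurePreserving {Ω' : Type*} [MeasurableSpace Ω'] {Q : Measure Ω'}
    [IsProbabilityMeasure Q] {f : Ω' → Ω} (hf : MeasurePreserving f Q P)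
    (X : Lp (EuclideanSpace ℝ (Fin d)) 2 P) :
    law (Lp.compMeasurePreservingₗᵢ ℝ f hf X) = law X := by
  refine law_eq_of_ae_eq (Lp.coeFn_compMeasurePreserving X hf) ?_
  rw [← AEMeasurable.map_map_of_aemeasurable (by rw [hf.map_eq]; fun_prop) hf.aemeasurable,
    hf.map_eq]
  rfl

theorem exists_dist_compMeasurePreserving_fst_eq_W2 (X : Lp (EuclideanSpace ℝ (Fin d)) 2 P)
    (ν : P2 d) : ∃ (Q : Measure (Ω × EuclideanSpace ℝ (Fin d))) (_ : IsProbabilityMeasure Q)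
      (hfst : MeasurePreserving Prod.fst Q P) (Y : Lp (EuclideanSpace ℝ (Fin d)) 2 Q),
      law Y = ν ∧ dist (Lp.compMeasurePreservingₗᵢ ℝ Prod.fst hfst X) Y = W2 (law X) ν := by
  obtain ⟨_, hγ, hcost⟩ := exists_optimal_coupling (law X) ν
  obtain ⟨γ, -, rfl⟩ := mem_couplings_iff.1 hγ
  have hX : Measurable X := (Lp.stronglyMeasurable X).measurable
  obtain ⟨Q, hQP, hQγ⟩ := exists_fst_eq_map_prodMap_eq hX hγ.1
  have hfst : MeasurePreserving Prod.fst Q P := ⟨measurable_fst, hQP⟩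
  have hsnd : MeasurePreserving Prod.snd Q ν.toMeasure := by
    refine ⟨measurable_snd, ?_⟩
    rw [← hγ.2, ← hQγ, Measure.map_map measurable_snd (by fun_prop)]
    rfl
  have : IsProbabilityMeasure (Q.map Prod.snd) := hsnd.map_eq ▸ inferInstance
  have hQ : IsProbabilityMeasure Q := Measure.isProbabilityMeasure_of_map Prod.snd
  have hYL := (memLp_id_toMeasure ν).comp_measurePreserving hsnd
  have hlaw : law hYL.toLp = ν := law_eq_of_ae_eq hYL.coeFn_toLp hsnd.map_eq
  refine ⟨Q, hQ, hfst, hYL.toLp, hlaw, ?_⟩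
  have hedist : edist (Lp.compMeasurePreservingₗᵢ ℝ Prod.fst hfst X) hYL.toLp ^ 2 =
      transportCost (law X) ν := by
    rw [edist_sq_eq_lintegral, ← hcost, ← hQγ, lintegral_map (by fun_prop) (by fun_prop)]
    refine lintegral_congr_ae ?_
    filter_upwards [Lp.coeFn_compMeasurePreserving X hfst, hYL.coeFn_toLp] with p hXp hYp
    exact congrArg₂ (fun x y => ‖x - y‖ₑ ^ 2) hXp hYp
  rw [W2, ← hedist, ENNReal.toReal_pow, ← dist_edist, Real.sqrt_sq dist_nonneg]

theorem exists_dist_eq_W2_and_dist_eq_W2 (μ ρ₀ ρ₁ : P2 d) :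
    ∃ (Ω : Type) (_ : MeasurableSpace Ω) (P : Measure Ω) (_ : IsProbabilityMeasure P)
      (Z X Y : Lp (EuclideanSpace ℝ (Fin d)) 2 P), law Z = μ ∧ law X = ρ₀ ∧ law Y = ρ₁ ∧
        dist Z X = W2 μ ρ₀ ∧ dist Z Y = W2 μ ρ₁ := by
  let Z₀ := (memLp_id_toMeasure μ).toLp
  have hZ₀ : law Z₀ = μ := law_eq_of_ae_eq (MemLp.coeFn_toLp _) Measure.map_id
  obtain ⟨Q₁, _, hfst₁, X, hX, hdistX⟩ := exists_dist_compMeasurePreserving_fst_eq_W2 Z₀ ρ₀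
  set Z₁ := Lp.compMeasurePreservingₗᵢ ℝ Prod.fst hfst₁ Z₀
  have hZ₁ : law Z₁ = μ := (law_compMeasurePreserving hfst₁ Z₀).trans hZ₀
  obtain ⟨Q₂, _, hfst₂, Y, hY, hdistY⟩ := exists_dist_compMeasurePreserving_fst_eq_W2 Z₁ ρ₁
  let pullback := Lp.compMeasurePreservingₗᵢ (E := EuclideanSpace ℝ (Fin d)) (p := 2) ℝ _ hfst₂
  refine ⟨_, _, Q₂, ‹_›, pullback Z₁, pullback X, Y, ?_, ?_, hY, ?_, ?_⟩
  · exact (law_compMeasurePreserving hfst₂ Z₁).trans hZ₁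
  · exact (law_compMeasurePreserving hfst₂ X).trans hX
  · rw [pullback.dist_map, hdistX, hZ₀]
  · rw [hdistY, hZ₁]

theorem W2_triangle (μ ν ρ : P2 d) : W2 μ ρ ≤ W2 μ ν + W2 ν ρ := by
  obtain ⟨Ω, _, P, _, Z, X, Y, -, rfl, rfl, hX, hY⟩ := exists_dist_eq_W2_and_dist_eq_W2 ν μ ρ
  calc W2 (law X) (law Y)
    _ ≤ dist X Y := W2_law_le_dist X Y
    _ ≤ dist Z X + dist Z Y := dist_triangle_left X Y Z
    _ = W2 (law X) ν + W2 ν (law Y) := by rw [hX, hY, W2_comm]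

theorem exists_lintegral_enorm_sq_le (μ : P2 d) (r : ℝ) :
    ∃ C ≠ ∞, ∀ ν : P2 d, W2 μ ν ≤ r → ∫⁻ x, ‖x‖ₑ ^ 2 ∂ν.toMeasure ≤ C := by
  let Z := (memLp_id_toMeasure μ).toLp
  have hZ : law Z = μ := law_eq_of_ae_eq (MemLp.coeFn_toLp _) Measure.map_id
  refine ⟨ENNReal.ofReal (‖Z‖ + r) ^ 2, by finiteness, fun ν hν => ?_⟩
  obtain ⟨Q, _, hfst, Y, rfl, hdist⟩ := exists_dist_compMeasurePreserving_fst_eq_W2 Z ν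
  rw [lintegral_enorm_sq_law, ← ofReal_norm]
  gcongr
  set Z' := Lp.compMeasurePreservingₗᵢ ℝ Prod.fst hfst Z
  calc ‖Y‖
    _ ≤ ‖Z'‖ + dist Z' Y := by
      rw [dist_eq_norm]
      exact norm_le_norm_add_norm_sub _ _
    _ ≤ ‖Z‖ + r := by
      rw [hdist, hZ, LinearIsometry.norm_map]
      gcongr

end Laws

section Completeness

variable {d : ℕ}

theorem isCompact_setOfPred_W2_le (μ : P2 d) {r : ℝ} (hr : 0 ≤ r) :
    IsCompact {ν : P2 d | W2 μ ν ≤ r} := by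
  obtain ⟨C, hC, hball⟩ := exists_lintegral_enorm_sq_le μ r
  have hcompact : IsCompact {ν : P2 d | ∫⁻ x, ‖x‖ₑ ^ 2 ∂ν.toMeasure ≤ C} :=
    (Topology.IsInducing.subtypeVal.isCompact_preimage_iff fun ν hν =>
      mem_range.2 ⟨⟨ν, lt_of_le_of_lt hν hC.lt_top⟩, rfl⟩).2
      (isCompact_setOfPred_lintegral_enorm_pow_le two_ne_zero hC)
  exact hcompact.of_isClosed_subset
    ((isClosed_setOfPred_W2_le hr).preimage (Continuous.prodMk_right μ)) hball

/-- The space `P₂(ℝᵈ)` with the metric `W2`. It is a type synonym because `P2 d` already carries,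
as a subtype of `ProbabilityMeasure`, the topology of weak convergence. -/
def WassersteinSpace (d : ℕ) : Type := P2 d

noncomputable instance : MetricSpace (WassersteinSpace d) where
  dist μ ν := W2 (d := d) μ ν
  dist_self μ := by
    obtain ⟨Ω, _, P, _, Z, -, -, rfl, -⟩ := exists_dist_eq_W2_and_dist_eq_W2 (d := d) μ μ μ
    exact le_antisymm (by simpa using W2_law_le_dist Z Z) (W2_nonneg _ _)
  dist_comm := W2_comm
  dist_triangle := W2_triangle
  eq_of_dist_eq_zero := eq_of_W2_eq_zero

instance : CompleteSpace (WassersteinSpace d) := by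
  refine Metric.complete_of_cauchySeq_tendsto fun u hu => ?_
  obtain ⟨R, hR, hbdd⟩ := cauchySeq_bdd hu
  have hball : ∀ᶠ n in atTop, u n ∈ {ν : P2 d | W2 (u 0) ν ≤ R} := .of_forall fun n => (hbdd 0 n).le
  obtain ⟨μ, -, hμ⟩ := (isCompact_setOfPred_W2_le (u 0) hR.le).exists_mapClusterPt_of_frequently
    hball.frequently
  refine ⟨μ, Metric.tendsto_atTop.2 fun ε hε => ?_⟩
  obtain ⟨N, hN⟩ := Metric.cauchySeq_iff.1 hu (ε / 2) (half_pos hε)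
  refine ⟨N, fun n hn => ?_⟩
  have hclosed : IsClosed {ν : P2 d | W2 (u n) ν ≤ ε / 2} :=
    (isCompact_setOfPred_W2_le (u n) (half_pos hε).le).isClosed
  have hmem : W2 (u n) μ ≤ ε / 2 := by
    refine hclosed.mem_of_mapClusterPt hμ ?_
    filter_upwards [eventually_ge_atTop N] with m hm using (hN n hn m hm).le
  exact hmem.trans_lt (half_lt_self hε)

end Completeness

section Convexity

theorem dist_lineMap_sq {E : Type*} [NormedAddCommGroup E] [InnerProductSpace ℝ E] (x y z : E)
    (t : ℝ) : dist (AffineMap.lineMap x y t) z ^ 2 =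
      (1 - t) * dist x z ^ 2 + t * dist y z ^ 2 - t * (1 - t) * dist x y ^ 2 := by
  have hlin : AffineMap.lineMap x y t - z = (1 - t) • (x - z) + t • (y - z) := by
    rw [AffineMap.lineMap_apply_module]
    module
  have hsub : x - y = (x - z) - (y - z) := by abel
  simp only [dist_eq_norm, hlin, hsub, ← real_inner_self_eq_norm_sq, inner_add_left,
    inner_add_right, inner_sub_left, inner_sub_right, inner_smul_left, inner_smul_right,
    conj_trivial]
  ring

variable {d : ℕ} {Ω : Type*} [MeasurableSpace Ω] {P : Measure Ω} [IsProbabilityMeasure P]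

theorem W2_law_lineMap_sq_le (X Y Z : Lp (EuclideanSpace ℝ (Fin d)) 2 P) (t : ℝ) :
    W2 (law (AffineMap.lineMap X Y t)) (law Z) ^ 2 ≤
      (1 - t) * dist X Z ^ 2 + t * dist Y Z ^ 2 - t * (1 - t) * dist X Y ^ 2 := by
  rw [← dist_lineMap_sq]
  gcongr
  · exact W2_nonneg _ _
  · exact W2_law_le_dist _ _

theorem le_W2_law_lineMap_sq (X Y : Lp (EuclideanSpace ℝ (Fin d)) 2 P) (ν : P2 d) {t : ℝ}
    (ht : t ∈ Icc (0 : ℝ) 1) :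
    (1 - t) * W2 (law X) ν ^ 2 + t * W2 (law Y) ν ^ 2 - t * (1 - t) * dist X Y ^ 2 ≤
      W2 (law (AffineMap.lineMap X Y t)) ν ^ 2 := by
  obtain ⟨Q, _, hfst, V, rfl, hV⟩ :=
    exists_dist_compMeasurePreserving_fst_eq_W2 (AffineMap.lineMap X Y t) ν
  set pullback := Lp.compMeasurePreservingₗᵢ (E := EuclideanSpace ℝ (Fin d)) (p := 2) ℝ _ hfst
  have hle (U : Lp (EuclideanSpace ℝ (Fin d)) 2 P) : W2 (law U) (law V) ≤ dist (pullback U) V :=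
    law_compMeasurePreserving hfst U ▸ W2_law_le_dist (pullback U) V
  have hlineMap : pullback (AffineMap.lineMap X Y t) =
      AffineMap.lineMap (pullback X) (pullback Y) t :=
    pullback.toLinearMap.toAffineMap.apply_lineMap X Y t
  have ht' : 0 ≤ 1 - t := sub_nonneg.2 ht.2
  rw [← hV, hlineMap, dist_lineMap_sq, pullback.dist_map]
  gcongr
  exacts [W2_nonneg _ _, hle X, ht.1, W2_nonneg _ _, hle Y]

theorem metricStrongConvex_distExtrapolation {α : ℝ} (hα : 1 ≤ α) (μ₀ μ₁ : WassersteinSpace d) :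
    MetricStrongConvex 2 (distExtrapolation α μ₀ μ₁) := by
  intro ρ₀ ρ₁ t ht
  obtain ⟨Ω, _, P, _, Z, X, Y, rfl, rfl, rfl, hX, hY⟩ :=
    exists_dist_eq_W2_and_dist_eq_W2 μ₁ ρ₀ ρ₁
  have hconvex := mul_le_mul_of_nonneg_left (W2_law_lineMap_sq_le X Y Z t) (zero_le_one.trans hα)
  have hconcave := mul_le_mul_of_nonneg_left (le_W2_law_lineMap_sq X Y μ₀ ht) (sub_nonneg.2 hα)
  have hdist : t * (1 - t) * W2 (law X) (law Y) ^ 2 ≤ t * (1 - t) * dist X Y ^ 2 := by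
    gcongr
    · exact mul_nonneg ht.1 (sub_nonneg.2 ht.2)
    · exact W2_nonneg _ _
    · exact W2_law_le_dist X Y
  rw [dist_comm X Z, dist_comm Y Z, hX, hY, W2_comm (law Z) (law X), W2_comm (law Z) (law Y)]
    at hconvex
  refine ⟨law (AffineMap.lineMap X Y t), ?_⟩
  change extrapolationFunctional α μ₀ (law Z) (law (AffineMap.lineMap X Y t)) ≤
    (1 - t) * extrapolationFunctional α μ₀ (law Z) (law X) +
      t * extrapolationFunctional α μ₀ (law Z) (law Y) -
      t * (1 - t) * (2 / 2 * W2 (law X) (law Y) ^ 2)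
  simp only [extrapolationFunctional]
  linarith

end Convexity

section Extrapolation

variable {d : ℕ} {α : ℝ} {μ₀ μ₁ : P2 d}

theorem existsUnique_isMetricExtrapolation (hα : 1 ≤ α) (μ₀ μ₁ : P2 d) :
    ∃! μ, IsMetricExtrapolation α μ₀ μ₁ μ := by
  have : Nonempty (WassersteinSpace d) := ⟨μ₀⟩
  have hconvex := metricStrongConvex_distExtrapolation (d := d) hα μ₀ μ₁
  obtain ⟨ρ, hρ⟩ := hconvex.exists_isMinOn two_pos
    (continuous_distExtrapolation _ _).lowerSemicontinuous (bddBelow_range_distExtrapolation hα _ _)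
  exact ⟨ρ, hρ, fun μ hμ => eq_of_W2_eq_zero (hconvex.dist_eq_zero_of_isMinOn two_pos hμ hρ)⟩

namespace IsMetricExtrapolation

theorem W2_sq_add_le (hα : 1 ≤ α) {ρ : P2 d} (hρ : IsMetricExtrapolation α μ₀ μ₁ ρ) (μ : P2 d) :
    W2 μ ρ ^ 2 + extrapolationFunctional α μ₀ μ₁ ρ ≤ extrapolationFunctional α μ₀ μ₁ μ := by
  have hle := (metricStrongConvex_distExtrapolation (d := d) hα μ₀ μ₁).dist_sq_add_le_of_isMinOn
    hρ μ
  rw [div_self two_ne_zero, one_mul] at hle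
  rw [W2_comm]
  exact hle

theorem W2_le (hα : 1 ≤ α) {ρ : P2 d} (hρ : IsMetricExtrapolation α μ₀ μ₁ ρ) :
    W2 μ₁ ρ ≤ (α - 1) * W2 μ₀ μ₁ :=
  dist_le_of_dist_sq_add_distExtrapolation_le (X := WassersteinSpace d) hα (hρ.W2_sq_add_le hα μ₁)

end IsMetricExtrapolation

end Extrapolation

end WassersteinExtrapolation

theorem mainTheorem3 (d : ℕ) (α : ℝ) (hα : 1 < α) :
    (∀ μ₀ μ₁ : WassersteinExtrapolation.P2 d,
      ∃! μα : WassersteinExtrapolation.P2 d,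
        WassersteinExtrapolation.IsMetricExtrapolation α μ₀ μ₁ μα) ∧
    ∀ E : WassersteinExtrapolation.P2 d → WassersteinExtrapolation.P2 d →
        WassersteinExtrapolation.P2 d,
      (∀ μ₀ μ₁ : WassersteinExtrapolation.P2 d,
        WassersteinExtrapolation.IsMetricExtrapolation α μ₀ μ₁ (E μ₀ μ₁)) →
      WassersteinExtrapolation.IsDissipative (α - 1) E ∧
      ∀ μ₀ μ₁ μ : WassersteinExtrapolation.P2 d,
        WassersteinExtrapolation.W2 μ (E μ₀ μ₁) ^ 2 +
            WassersteinExtrapolation.extrapolationFunctional α μ₀ μ₁ (E μ₀ μ₁) ≤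
          WassersteinExtrapolation.extrapolationFunctional α μ₀ μ₁ μ :=
  ⟨WassersteinExtrapolation.existsUnique_isMetricExtrapolation hα.le, fun _ hE =>
    ⟨⟨sub_nonneg.2 hα.le, fun μ₀ μ₁ => (hE μ₀ μ₁).W2_le hα.le⟩,
      fun μ₀ μ₁ => (hE μ₀ μ₁).W2_sq_add_le hα.le⟩⟩
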